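/- A pairwise comparison matrix (PCM) of size $n$ is a real $n\times n$ matrix $A=[a_{ij}]$ with $a_{ij}>0$ and $a_{ij}=1/a_{ji}$ for all $i,j$; it is consistent if $a_{ik}a_{kj}=a_{ij}$ for all $i,j,k$. A PCM $A$ is double perturbed if there is a consistent PCM $B$ such that $A$ and $B$ differ in exactly two off-diagonal elements and their reciprocals, that is, there are indices $i\neq j$ and $k\neq l$ with $\{i,j\}\neq\{k,l\}$ such that $a_{pq}\neq b_{pq}$ holds exactly when $\{p,q\}=\{i,j\}$ or $\{p,q\}=\{k,l\}$. The principal right eigenvector of $A$ is the vector $w$ with positive coordinates, unique up to a positive factor, such that $Aw=\lambda_{\max}w$, where $\lambda_{\max}$ is the principal (Perron) eigenvalue of $A$, i.e. the real eigenvalue that is an upper bound for the moduli of all complex eigenvalues of $A$. A positive vector $w$ is (Pareto) efficient for $A$ if there is no positive vector $w'$ such that $$\left|a_{ij}-\frac{w'_i}{w'_j}\right|\le\left|a_{ij}-\frac{w_i}{w_j}\right|\quad\text{for all } 1\le i,j\le n,$$ with strict inequality for at least one pair $(i,j)$. Theorem. Let $n\ge 4$ and let $A$ be a double perturbed PCM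 of size $n$. Then the principal right eigenvector of $A$ is efficient. -/

import Mathlib

namespace PairwiseComparison

/-- A pairwise comparison matrix: positive entries with `a i j = 1 / a j i`
(so that `a i i = 1`). -/
structure IsPCM {n : ℕ} (A : Matrix (Fin n) (Fin n) ℝ) : Prop where
  pos : ∀ i j, 0 < A i j
  reciprocal : ∀ i j, A i j = 1 / A j i

/-- A consistent pairwise comparison matrix: cardinal transitivity holds. -/
structure IsConsistent {n : ℕ} (A : Matrix (Fin n) (Fin n) ℝ) : Prop where
  isPCM : IsPCM A
  trans : ∀ i j k, A i k * A k j = A i j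

/-- A double perturbed pairwise comparison matrix: it differs from some consistent pairwise
comparison matrix `B` in exactly two off-diagonal elements, at the positions `(i, j)` and
`(k, l)`, and in their reciprocals, at the positions `(j, i)` and `(l, k)`. -/
def IsDoublePerturbed {n : ℕ} (A : Matrix (Fin n) (Fin n) ℝ) : Prop :=
  IsPCM A ∧
    ∃ B : Matrix (Fin n) (Fin n) ℝ, IsConsistent B ∧
      ∃ i j k l : Fin n, i ≠ j ∧ k ≠ l ∧ s(i, j) ≠ s(k, l) ∧
        ∀ p q : Fin n, A p q ≠ B p q ↔ (s(p, q) = s(i, j) ∨ s(p, q) = s(k, l))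

/-- `lam` is the principal (Perron) eigenvalue of the real matrix `A`: it is an eigenvalue,
and it bounds the modulus of every complex eigenvalue. -/
def IsPrincipalEigenvalue {n : ℕ} (A : Matrix (Fin n) (Fin n) ℝ) (lam : ℝ) : Prop :=
  Module.End.HasEigenvalue (Matrix.toLin' A) lam ∧
    ∀ μ : ℂ, Module.End.HasEigenvalue (Matrix.toLin' (A.map Complex.ofReal)) μ → ‖μ‖ ≤ lam

/-- `w` is a principal right (Perron) eigenvector of `A`: a positive vector with
`A w = lam w`, where `lam` is the principal eigenvalue. -/
def IsPrincipalRightEigenvector {n : ℕ} (A : Matrix (Fin n) (Fin n) ℝ) (w : Fin n → ℝ) : Prop :=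
  (∀ i, 0 < w i) ∧ ∃ lam : ℝ, IsPrincipalEigenvalue A lam ∧ A.mulVec w = lam • w

/-- A positive weight vector `w` is (Pareto) efficient for `A` if no other positive weight vector
approximates every entry of `A` at least as well and some entry strictly better. -/
def IsEfficient {n : ℕ} (A : Matrix (Fin n) (Fin n) ℝ) (w : Fin n → ℝ) : Prop :=
  (∀ i, 0 < w i) ∧
    ¬ ∃ w' : Fin n → ℝ, (∀ i, 0 < w' i) ∧
      (∀ i j, |A i j - w' i / w' j| ≤ |A i j - w i / w j|) ∧
      ∃ k l, |A k l - w' k / w' l| < |A k l - w k / w l|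

end PairwiseComparison

namespace PairwiseComparison

/-! Rescale to e_ij = a_ij w_j / w_i, a reciprocal array whose row sums all equal λ. A vector w'
dominating w would produce a cut: if S is the set where w'/w is maximal, every ratio leaving S
grows, so every e_ij leaving S must exceed 1 (`isEfficient_of_forall_not_isCut`). It remains to
exclude cuts (`IsBalanced.not_isCut`).

Off the two perturbed pairs, e_ij = v_i / v_j with v a rescaled column of B. Hence an unperturbed
row has v_i equal to the level V = λ / ∑ 1/v_j, and a row whose perturbed entries are all raised
(lowered) has v_i below (above) V. An unperturbed entry leaving S needs v_j < v_i, which leaves few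
candidates for S. Row sums kill these: no row strictly dominates another (`not_row_lt`), and since λ
≥ n, no row is at most 1 throughout with an entry below 1 (`not_row_lt_one`). -/

/-- A positive reciprocal array `E` with constant row sums `lam`, together with a positive
reference vector `v`. -/
structure IsBalanced {ι : Type*} [Fintype ι] (E : ι → ι → ℝ) (v : ι → ℝ) (lam : ℝ) : Prop where
  pos : ∀ i j, 0 < E i j
  mul_swap : ∀ i j, E i j * E j i = 1
  ref_pos : ∀ i, 0 < v i
  row_sum : ∀ i, ∑ j, E i j = lam

/-- `S` is a proper nonempty set such that all entries of `E` from `S` to its complement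
exceed `1`. -/
structure IsCut {ι : Type*} (E : ι → ι → ℝ) (S : Set ι) : Prop where
  nonempty : ∃ i, i ∈ S
  compl_nonempty : ∃ i, i ∉ S
  one_lt : ∀ i ∈ S, ∀ j ∉ S, 1 < E i j

theorem forall_of_three {ι : Type*} {P : ι → Prop} {a b c : ι} (ha : P a) (hb : P b) (hc : P c)
    (h : ∀ p, p ≠ a → p ≠ b → p ≠ c → P p) (j : ι) : P j := by
  rcases eq_or_ne j a with rfl | hja
  · exact ha
  rcases eq_or_ne j b with rfl | hjb
  · exact hb
  rcases eq_or_ne j c with rfl | hjc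
  · exact hc
  exact h j hja hjb hjc

theorem forall_le_of_forall_ne {ι : Type*} {f g : ι → ℝ} {k : ι} (h : ∀ j, j ≠ k → f j = g j)
    (hk : f k < g k) (j : ι) : f j ≤ g j := by
  rcases eq_or_ne j k with rfl | hj
  · exact hk.le
  · exact (h j hj).le

namespace IsBalanced

variable {ι : Type*} [Fintype ι] {E : ι → ι → ℝ} {v : ι → ℝ} {lam : ℝ}

theorem diag (h : IsBalanced E v lam) (i : ι) : E i i = 1 := by
  nlinarith [h.mul_swap i i, h.pos i i]

theorem lt_one_of_swap (h : IsBalanced E v lam) {i j : ι} (hij : 1 < E i j) : E j i < 1 := by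
  nlinarith [h.mul_swap i j, h.pos j i]

theorem le_one_of_swap (h : IsBalanced E v lam) {i j : ι} (hij : 1 ≤ E i j) : E j i ≤ 1 := by
  nlinarith [h.mul_swap i j, h.pos j i]

theorem lt_div_swap (h : IsBalanced E v lam) {i j : ι} (hij : v i / v j < E i j) :
    E j i < v j / v i := by
  have hi := h.ref_pos i
  have hj := h.ref_pos j
  rw [div_lt_iff₀ hj] at hij
  rw [lt_div_iff₀ hi]
  calc E j i * v i < E j i * (E i j * v j) := by gcongr; exact h.pos j i
    _ = v j := by rw [← mul_assoc, h.mul_swap, one_mul]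

theorem div_lt_swap (h : IsBalanced E v lam) {i j : ι} (hij : E i j < v i / v j) :
    v j / v i < E j i := by
  have hi := h.ref_pos i
  have hj := h.ref_pos j
  rw [lt_div_iff₀ hj] at hij
  rw [div_lt_iff₀ hi]
  calc v j = E j i * (E i j * v j) := by rw [← mul_assoc, h.mul_swap, one_mul]
    _ < E j i * v i := by gcongr; exact h.pos j i

/-! ### Row-sum obstructions and the level V. -/

/-- No row strictly dominates another one. -/
theorem not_row_lt (h : IsBalanced E v lam) {i k : ι} (hle : ∀ j, E i j ≤ E k j) (j : ι)
    (hlt : E i j < E k j) : False := by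
  have := Finset.sum_lt_sum (fun j _ => hle j) ⟨j, Finset.mem_univ j, hlt⟩
  rw [h.row_sum, h.row_sum] at this
  exact lt_irrefl _ this

/-- Sum e_ij + e_ji ≥ 2 over all pairs. -/
theorem card_le (h : IsBalanced E v lam) (i : ι) : (Fintype.card ι : ℝ) ≤ lam := by
  have h1 : ∑ i, ∑ j, E i j = Fintype.card ι * lam := by simp [h.row_sum]
  have h2 : ∑ i, ∑ j, E j i = Fintype.card ι * lam := by rw [Finset.sum_comm, h1]
  have h3 : ∑ _i : ι, ∑ _j : ι, (2 : ℝ) ≤ ∑ i, ∑ j, (E i j + E j i) := by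
    refine Finset.sum_le_sum fun i _ => Finset.sum_le_sum fun j _ => ?_
    nlinarith [h.mul_swap i j, h.pos i j, h.pos j i, sq_nonneg (E i j - E j i)]
  simp only [Finset.sum_add_distrib, h1, h2] at h3
  simp only [Finset.sum_const, Finset.card_univ, nsmul_eq_mul] at h3
  have : (0 : ℝ) < Fintype.card ι := by
    exact_mod_cast Fintype.card_pos_iff.mpr ⟨i⟩
  nlinarith

/-- The entries of a row cannot all be at most `1` with one of them smaller. -/
theorem not_row_lt_one (h : IsBalanced E v lam) {i : ι} (hle : ∀ j, E i j ≤ 1) (j : ι)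
    (hlt : E i j < 1) : False := by
  have := Finset.sum_lt_sum (fun j _ => hle j) ⟨j, Finset.mem_univ j, hlt⟩
  rw [h.row_sum] at this
  have h' := h.card_le i
  simp only [Finset.sum_const, Finset.card_univ, nsmul_eq_mul, mul_one] at this
  linarith

theorem sum_inv_pos (h : IsBalanced E v lam) (i : ι) : 0 < ∑ j, (v j)⁻¹ :=
  Finset.sum_pos (fun j _ => inv_pos.mpr (h.ref_pos j)) ⟨i, Finset.mem_univ i⟩

theorem eq_level (h : IsBalanced E v lam) {i : ι} (hi : ∀ j, E i j = v i / v j) :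
    v i = lam / ∑ j, (v j)⁻¹ := by
  rw [eq_div_iff (h.sum_inv_pos i).ne', ← h.row_sum i, Finset.mul_sum]
  simp only [hi, div_eq_mul_inv]

theorem lt_level (h : IsBalanced E v lam) {i : ι} (hi : ∀ j, v i / v j ≤ E i j) (k : ι)
    (hk : v i / v k < E i k) : v i < lam / ∑ j, (v j)⁻¹ := by
  rw [lt_div_iff₀ (h.sum_inv_pos i), ← h.row_sum i, Finset.mul_sum]
  simp only [div_eq_mul_inv] at hi hk
  exact Finset.sum_lt_sum (fun j _ => hi j) ⟨k, Finset.mem_univ k, hk⟩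

theorem level_lt (h : IsBalanced E v lam) {i : ι} (hi : ∀ j, E i j ≤ v i / v j) (k : ι)
    (hk : E i k < v i / v k) : lam / ∑ j, (v j)⁻¹ < v i := by
  rw [div_lt_iff₀ (h.sum_inv_pos i), ← h.row_sum i, Finset.mul_sum]
  simp only [div_eq_mul_inv] at hi hk
  exact Finset.sum_lt_sum (fun j _ => hi j) ⟨k, Finset.mem_univ k, hk⟩

theorem ref_lt (h : IsBalanced E v lam) {S : Set ι} (hS : IsCut E S) {i j : ι} (hi : i ∈ S)
    (hj : j ∉ S) (hij : E i j = v i / v j) : v j < v i := by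
  have := hS.one_lt i hi j hj
  rwa [hij, one_lt_div (h.ref_pos j)] at this

theorem entry_lt_one (h : IsBalanced E v lam) {i j : ι} (hij : E i j = v i / v j)
    (hv : v i < v j) : E i j < 1 := by
  rwa [hij, div_lt_one (h.ref_pos j)]

theorem entry_lt_entry (h : IsBalanced E v lam) {i j k : ι} (hij : E i j ≤ v i / v j)
    (hkj : v k / v j ≤ E k j) (hv : v i < v k) : E i j < E k j :=
  hij.trans_lt ((div_lt_div_of_pos_right hv (h.ref_pos j)).trans_le hkj)

/-! ### Disjoint perturbed pairs. -/

/-- For an isolated raised entry `E a b` the opposite entry stays below `1`. -/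
theorem swap_lt_one_of_isolated (h : IsBalanced E v lam) {a b c : ι} (hca : c ≠ a) (hcb : c ≠ b)
    (hab : v a / v b < E a b) (ha : ∀ j, j ≠ b → E a j = v a / v j)
    (hb : ∀ j, j ≠ a → E b j = v b / v j) : E b a < 1 := by
  -- Otherwise v a < v b, and row b dominates row a, strictly in column c.
  by_contra! hge
  have hlt : v a < v b := (one_lt_div (h.ref_pos a)).mp (hge.trans_lt (h.lt_div_swap hab))
  have key : ∀ j, j ≠ a → j ≠ b → E a j < E b j := fun j hja hjb =>
    h.entry_lt_entry (ha j hjb).le (hb j hja).ge hlt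
  refine h.not_row_lt (i := a) (k := b) (fun j => ?_) c (key c hca hcb)
  rcases eq_or_ne j a with rfl | hja
  · rw [h.diag]; exact hge
  rcases eq_or_ne j b with rfl | hjb
  · rw [h.diag]; exact h.le_one_of_swap hge
  exact (key j hja hjb).le

/-- Two raised entries in disjoint positions. -/
theorem not_isCut_of_disjoint (h : IsBalanced E v lam) {a b c d : ι} (hab : a ≠ b) (hcd : c ≠ d)
    (hac : a ≠ c) (had : a ≠ d) (hbc : b ≠ c) (hbd : b ≠ d)
    (h1 : v a / v b < E a b) (h2 : v c / v d < E c d)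
    (hE : ∀ p q, s(p, q) ≠ s(a, b) → s(p, q) ≠ s(c, d) → E p q = v p / v q) (S : Set ι) :
    ¬ IsCut E S := by
  intro hS
  have ha : ∀ j, j ≠ b → E a j = v a / v j := fun j hj =>
    hE _ _ (by grind [Sym2.eq_iff]) (by grind [Sym2.eq_iff])
  have hb : ∀ j, j ≠ a → E b j = v b / v j := fun j hj =>
    hE _ _ (by grind [Sym2.eq_iff]) (by grind [Sym2.eq_iff])
  have hc : ∀ j, j ≠ d → E c j = v c / v j := fun j hj =>
    hE _ _ (by grind [Sym2.eq_iff]) (by grind [Sym2.eq_iff])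
  have hd : ∀ j, j ≠ c → E d j = v d / v j := fun j hj =>
    hE _ _ (by grind [Sym2.eq_iff]) (by grind [Sym2.eq_iff])
  have hup : ∀ p, p ≠ a → p ≠ b → p ≠ c → p ≠ d → ∀ j, E p j = v p / v j :=
    fun p _ _ _ _ j => hE _ _ (by grind [Sym2.eq_iff]) (by grind [Sym2.eq_iff])
  clear hE
  have h1' := h.lt_div_swap h1
  have h2' := h.lt_div_swap h2
  have hva := h.lt_level (forall_le_of_forall_ne (fun j hj => (ha j hj).symm) h1) b h1
  have hvb := h.level_lt (forall_le_of_forall_ne (hb) h1') a h1'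
  have hvc := h.lt_level (forall_le_of_forall_ne (fun j hj => (hc j hj).symm) h2) d h2
  have hvd := h.level_lt (forall_le_of_forall_ne (hd) h2') c h2'
  have hu : ∀ p, p ≠ a → p ≠ b → p ≠ c → p ≠ d → v p = lam / ∑ j, (v j)⁻¹ :=
    fun p hpa hpb hpc hpd => h.eq_level (hup p hpa hpb hpc hpd)
  have hba := h.swap_lt_one_of_isolated hac.symm hbc.symm h1 ha hb
  have hdc := h.swap_lt_one_of_isolated hac had h2 hc hd
  -- With `hba` and `hdc`, a cut containing b (or d) also contains a (or c).
  have hSab : a ∉ S → b ∉ S := fun h1 h2 => (hS.one_lt b h2 a h1).not_gt hba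
  have hScd : c ∉ S → d ∉ S := fun h1 h2 => (hS.one_lt d h2 c h1).not_gt hdc
  by_cases haS : a ∈ S
  · by_cases hcS : c ∈ S
    · obtain ⟨q, hq⟩ := hS.compl_nonempty
      rcases eq_or_ne q b with rfl | hqb
      · have := h.ref_lt hS hcS hq (hc _ hbd)
        linarith
      · have := h.ref_lt hS haS hq (ha _ hqb)
        exact hq (forall_of_three (P := fun q => v q < v a → q ∈ S) (b := b) (fun _ => haS)
          (fun hlt => by linarith) (fun _ => hcS) (fun p hpa hpb hpc hlt => by
            rcases eq_or_ne p d with rfl | hpd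
            · linarith
            · linarith [hu p hpa hpb hpc hpd]) q this)
    · have := h.ref_lt hS haS (hScd hcS) (ha _ hbd.symm)
      linarith
  · by_cases hcS : c ∈ S
    · have := h.ref_lt hS hcS (hSab haS) (hc _ hbd)
      linarith
    · obtain ⟨p, hp⟩ := hS.nonempty
      refine forall_of_three (P := (· ∉ S)) haS (hSab haS) hcS (fun p hpa hpb hpc hp => ?_) p hp
      have hpd : p ≠ d := fun hpd => hScd hcS (hpd ▸ hp)
      have := h.ref_lt hS hp (hSab haS) (hup p hpa hpb hpc hpd b)
      linarith [hu p hpa hpb hpc hpd]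

/-! ### Perturbed pairs sharing an index. -/

/-- The facts on unperturbed entries when the perturbed pairs are `{a, b}` and `{a, c}`. -/
theorem unperturbed_of_adjacent (h : IsBalanced E v lam) {a b c : ι} (hab : a ≠ b)
    (hac : a ≠ c) (hbc : b ≠ c)
    (hE : ∀ p q, s(p, q) ≠ s(a, b) → s(p, q) ≠ s(a, c) → E p q = v p / v q) :
    (∀ j, j ≠ b → j ≠ c → E a j = v a / v j) ∧ (∀ j, j ≠ a → E b j = v b / v j) ∧
    (∀ j, j ≠ a → E c j = v c / v j) ∧
    (∀ p, p ≠ a → p ≠ b → p ≠ c → ∀ j, E p j = v p / v j) ∧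
    ∀ p, p ≠ a → p ≠ b → p ≠ c → v p = lam / ∑ j, (v j)⁻¹ := by
  have hu : ∀ p, p ≠ a → p ≠ b → p ≠ c → ∀ j, E p j = v p / v j := fun p _ _ _ j =>
    hE _ _ (by grind [Sym2.eq_iff]) (by grind [Sym2.eq_iff])
  refine ⟨fun j _ _ => ?_, fun j _ => ?_, fun j _ => ?_, hu,
    fun p h1 h2 h3 => h.eq_level (hu p h1 h2 h3)⟩
  all_goals exact hE _ _ (by grind [Sym2.eq_iff]) (by grind [Sym2.eq_iff])

/-- Two raised entries in a common row. -/
theorem not_isCut_of_raised (h : IsBalanced E v lam) {a b c u : ι} (hab : a ≠ b)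
    (hac : a ≠ c) (hbc : b ≠ c) (hua : u ≠ a) (hub : u ≠ b) (huc : u ≠ c)
    (h1 : v a / v b < E a b) (h2 : v a / v c < E a c)
    (hE : ∀ p q, s(p, q) ≠ s(a, b) → s(p, q) ≠ s(a, c) → E p q = v p / v q) (S : Set ι) :
    ¬ IsCut E S := by
  intro hS
  obtain ⟨ha, hb, hc, hu, hV⟩ := h.unperturbed_of_adjacent hab hac hbc hE
  clear hE
  have hEaa := ha a hab hac
  have h1' := h.lt_div_swap h1
  have h2' := h.lt_div_swap h2
  have hva := h.lt_level (forall_of_three hEaa.ge h1.le h2.le fun j _ hb hc => (ha j hb hc).ge) b h1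
  have hvb := h.level_lt (forall_le_of_forall_ne (hb) h1') a h1'
  have hvc := h.level_lt (forall_le_of_forall_ne (hc) h2') a h2'
  set V := lam / ∑ j, (v j)⁻¹
  have hau : ∀ p, p ≠ a → p ≠ b → p ≠ c → E a p < 1 := fun p h1 h2 h3 =>
    h.entry_lt_one (ha p h2 h3) (by rw [hV p h1 h2 h3]; exact hva)
  -- Row a is below 1 at unperturbed columns, so a raised entry must exceed 1.
  have hone : ¬ (E a b ≤ 1 ∧ E a c ≤ 1) := fun hle =>
    h.not_row_lt_one (i := a) (forall_of_three (h.diag a).le hle.1 hle.2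
      fun j hja hjb hjc => (hau j hja hjb hjc).le) u (hau u hua hub huc)
  -- Since v a < V < v b, v c, a cut containing a would absorb every index.
  have haS : a ∉ S := by
    intro haS
    have huS : u ∈ S := by
      by_contra huS
      have := h.ref_lt hS haS huS (ha u hub huc)
      linarith [hV u hua hub huc]
    have hbS : b ∈ S := by
      by_contra hbS
      have := h.ref_lt hS huS hbS (hu u hua hub huc b)
      linarith [hV u hua hub huc]
    have hcS : c ∈ S := by
      by_contra hcS
      have := h.ref_lt hS huS hcS (hu u hua hub huc c)
      linarith [hV u hua hub huc]
    obtain ⟨q, hq⟩ := hS.compl_nonempty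
    refine hq (forall_of_three haS hbS hcS (fun p hpa hpb hpc => ?_) q)
    by_contra hp
    have := h.ref_lt hS haS hp (ha p hpb hpc)
    linarith [hV p hpa hpb hpc]
  by_cases hbS : b ∈ S <;> by_cases hcS : c ∈ S
  · exact hone ⟨(h.lt_one_of_swap (hS.one_lt b hbS a haS)).le,
      (h.lt_one_of_swap (hS.one_lt c hcS a haS)).le⟩
  · have hba := hS.one_lt b hbS a haS
    have hcb := h.ref_lt hS hbS hcS (hb c hac.symm)
    -- This makes row b dominate row c.
    have hca : E c a ≤ 1 := by
      by_contra! hlt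
      exact hone ⟨(h.lt_one_of_swap hba).le, (h.lt_one_of_swap hlt).le⟩
    refine h.not_row_lt (i := c) (k := b) (fun j => ?_) a (hca.trans_lt hba)
    rcases eq_or_ne j a with rfl | hja
    · exact (hca.trans_lt hba).le
    · exact (h.entry_lt_entry (hc j hja).le (hb j hja).ge hcb).le
  · have hca := hS.one_lt c hcS a haS
    have hbc := h.ref_lt hS hcS hbS (hc b hab.symm)
    have hba : E b a ≤ 1 := by
      by_contra! hlt
      exact hone ⟨(h.lt_one_of_swap hlt).le, (h.lt_one_of_swap hca).le⟩
    refine h.not_row_lt (i := b) (k := c) (fun j => ?_) a (hba.trans_lt hca)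
    rcases eq_or_ne j a with rfl | hja
    · exact (hba.trans_lt hca).le
    · exact (h.entry_lt_entry (hb j hja).le (hc j hja).ge hbc).le
  · obtain ⟨p, hp⟩ := hS.nonempty
    refine forall_of_three (P := (· ∉ S)) haS hbS hcS (fun p hpa hpb hpc hp => ?_) p hp
    have := h.ref_lt hS hp hbS (hu p hpa hpb hpc b)
    linarith [hV p hpa hpb hpc]

/-- Two lowered entries in a common row. -/
theorem not_isCut_of_lowered (h : IsBalanced E v lam) {a b c u : ι} (hab : a ≠ b)
    (hac : a ≠ c) (hbc : b ≠ c) (hua : u ≠ a) (hub : u ≠ b) (huc : u ≠ c)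
    (h1 : E a b < v a / v b) (h2 : E a c < v a / v c)
    (hE : ∀ p q, s(p, q) ≠ s(a, b) → s(p, q) ≠ s(a, c) → E p q = v p / v q) (S : Set ι) :
    ¬ IsCut E S := by
  intro hS
  obtain ⟨ha, hb, hc, hu, hV⟩ := h.unperturbed_of_adjacent hab hac hbc hE
  clear hE
  have hEaa := ha a hab hac
  have h1' := h.div_lt_swap h1
  have h2' := h.div_lt_swap h2
  have hva := h.level_lt (forall_of_three hEaa.le h1.le h2.le fun j _ hb hc => (ha j hb hc).le) b h1
  have hvb := h.lt_level (forall_le_of_forall_ne (fun j hj => (hb j hj).symm) h1') a h1'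
  have hvc := h.lt_level (forall_le_of_forall_ne (fun j hj => (hc j hj).symm) h2') a h2'
  set V := lam / ∑ j, (v j)⁻¹
  have hbu : ∀ p, p ≠ a → p ≠ b → p ≠ c → E b p < 1 := fun p h1 h2 h3 =>
    h.entry_lt_one (hb p h1) (by rw [hV p h1 h2 h3]; exact hvb)
  have hcu : ∀ p, p ≠ a → p ≠ b → p ≠ c → E c p < 1 := fun p h1 h2 h3 =>
    h.entry_lt_one (hc p h1) (by rw [hV p h1 h2 h3]; exact hvc)
  have hrb : E b a ≤ 1 → E b c ≤ 1 → False := fun hle1 hle2 =>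
    h.not_row_lt_one (i := b) (forall_of_three hle1 (h.diag b).le hle2
      fun j hja hjb hjc => (hbu j hja hjb hjc).le) u (hbu u hua hub huc)
  have hrc : E c a ≤ 1 → E c b ≤ 1 → False := fun hle1 hle2 =>
    h.not_row_lt_one (i := c) (forall_of_three hle1 hle2 (h.diag c).le
      fun j hja hjb hjc => (hcu j hja hjb hjc).le) u (hcu u hua hub huc)
  have hbc_or : E b c ≤ 1 ∨ E c b ≤ 1 := by
    by_contra! hlt
    exact (h.lt_one_of_swap hlt.1).not_gt hlt.2
  -- Both v b and v c lie below V, so no unperturbed index can be outside.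
  have hsub : b ∈ S ∨ c ∈ S → ∀ p, p ≠ a → p ≠ b → p ≠ c → p ∈ S := by
    rintro (hm | hm) p hpa hpb hpc <;> by_contra hp
    · have := h.ref_lt hS hm hp (hb p hpa)
      linarith [hV p hpa hpb hpc]
    · have := h.ref_lt hS hm hp (hc p hpa)
      linarith [hV p hpa hpb hpc]
  have haS : a ∈ S := by
    by_contra haS
    have huS : ∀ p, p ≠ a → p ≠ b → p ≠ c → p ∉ S := fun p hpa hpb hpc hp => by
      have := h.ref_lt hS hp haS (hu p hpa hpb hpc a)
      linarith [hV p hpa hpb hpc, hV u hua hub huc]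
    obtain ⟨p, hp⟩ := hS.nonempty
    by_cases hbc : b ∈ S ∨ c ∈ S
    · exact huS u hua hub huc (hsub hbc u hua hub huc)
    · rw [not_or] at hbc
      exact forall_of_three (P := (· ∉ S)) haS hbc.1 hbc.2 huS p hp
  by_cases hbS : b ∈ S <;> by_cases hcS : c ∈ S
  · obtain ⟨q, hq⟩ := hS.compl_nonempty
    exact hq (forall_of_three haS hbS hcS (hsub (Or.inl hbS)) q)
  · exact hrc (h.lt_one_of_swap (hS.one_lt a haS c hcS)).le
      (h.lt_one_of_swap (hS.one_lt b hbS c hcS)).le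
  · exact hrb (h.lt_one_of_swap (hS.one_lt a haS b hbS)).le
      (h.lt_one_of_swap (hS.one_lt c hcS b hbS)).le
  · rcases hbc_or with hle | hle
    · exact hrb (h.lt_one_of_swap (hS.one_lt a haS b hbS)).le hle
    · exact hrc (h.lt_one_of_swap (hS.one_lt a haS c hcS)).le hle

/-- One raised and one lowered entry in a common row. -/
theorem not_isCut_of_mixed (h : IsBalanced E v lam) {a b c u : ι} (hab : a ≠ b)
    (hac : a ≠ c) (hbc : b ≠ c) (hua : u ≠ a) (hub : u ≠ b) (huc : u ≠ c)
    (h1 : v a / v b < E a b) (h2 : E a c < v a / v c)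
    (hE : ∀ p q, s(p, q) ≠ s(a, b) → s(p, q) ≠ s(a, c) → E p q = v p / v q) (S : Set ι) :
    ¬ IsCut E S := by
  intro hS
  obtain ⟨ha, hb, hc, hu, hV⟩ := h.unperturbed_of_adjacent hab hac hbc hE
  clear hE
  have hEaa := ha a hab hac
  have h1' := h.lt_div_swap h1
  have h2' := h.div_lt_swap h2
  have hvb := h.level_lt (forall_le_of_forall_ne (hb) h1') a h1'
  have hvc := h.lt_level (forall_le_of_forall_ne (fun j hj => (hc j hj).symm) h2') a h2'
  set V := lam / ∑ j, (v j)⁻¹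
  have hda := h.diag a
  have hdb := h.diag b
  have hdc := h.diag c
  -- Here v c < V < v b, but v a may lie on either side of V. If u ∈ S, then only a and c can be
  -- outside, and one of their rows is at most 1. If u ∉ S, then only a and b can be inside: row a
  -- dominates row c if a ∈ S, and row b dominates row a otherwise.
  by_cases huS : u ∈ S
  · have hbS : b ∈ S := by
      by_contra hbS
      have := h.ref_lt hS huS hbS (hu u hua hub huc b)
      linarith [hV u hua hub huc]
    have hpS : ∀ p, p ≠ a → p ≠ b → p ≠ c → p ∈ S := fun p hpa hpb hpc => by
      by_contra hp
      have := h.ref_lt hS huS hp (hu u hua hub huc p)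
      linarith [hV p hpa hpb hpc, hV u hua hub huc]
    have hlt : ∀ i ∈ S, ∀ j ∉ S, E j i < 1 := fun i hi j hj =>
      h.lt_one_of_swap (hS.one_lt i hi j hj)
    have hrow_a : a ∉ S → E a c ≤ 1 → False := fun haS hle =>
      h.not_row_lt_one (i := a) (forall_of_three hda.le (hlt b hbS a haS).le hle
        fun j hja hjb hjc => (hlt j (hpS j hja hjb hjc) a haS).le) u (hlt u huS a haS)
    by_cases hcS : c ∈ S
    · have haS : a ∉ S := by
        obtain ⟨q, hq⟩ := hS.compl_nonempty
        exact fun haS => hq (forall_of_three haS hbS hcS hpS q)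
      exact hrow_a haS (hlt c hcS a haS).le
    · by_cases hca : E c a ≤ 1
      · exact h.not_row_lt_one (i := c) (forall_of_three hca (hlt b hbS c hcS).le hdc.le
          fun j hja hjb hjc => (hlt j (hpS j hja hjb hjc) c hcS).le) u (hlt u huS c hcS)
      · have hac' := h.lt_one_of_swap (not_le.mp hca)
        have haS : a ∉ S := fun haS => hca (hlt a haS c hcS).le
        exact hrow_a haS hac'.le
  · have hcS : c ∉ S := fun hcS => by
      have := h.ref_lt hS hcS huS (hc u hua)
      linarith [hV u hua hub huc]
    have hpS : ∀ p, p ≠ a → p ≠ b → p ≠ c → p ∉ S := fun p hpa hpb hpc hp => by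
      have := h.ref_lt hS hp huS (hu p hpa hpb hpc u)
      linarith [hV p hpa hpb hpc, hV u hua hub huc]
    by_cases haS : a ∈ S
    · have hva : V < v a := by
        have := h.ref_lt hS haS huS (ha u hub huc)
        linarith [hV u hua hub huc]
      have hca := hS.one_lt a haS c hcS
      refine h.not_row_lt (i := c) (k := a) (fun j => ?_) c (by rwa [hdc])
      rcases eq_or_ne j a with rfl | hja
      · rw [hda]; exact (h.lt_one_of_swap hca).le
      by_cases hjc : j = c
      · rw [hjc, hdc]; exact hca.le
      refine (h.entry_lt_entry (hc j hja).le ?_ (hvc.trans hva)).le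
      by_cases hjb : j = b
      · rw [hjb]; exact h1.le
      · exact (ha j hjb hjc).ge
    · have hbS : b ∈ S := by
        obtain ⟨p, hp⟩ := hS.nonempty
        by_contra hbS
        exact forall_of_three (P := (· ∉ S)) haS hbS hcS hpS p hp
      have hba := hS.one_lt b hbS a haS
      have hv : v a < v b := (one_lt_div (h.ref_pos a)).mp (hba.trans h1')
      refine h.not_row_lt (i := a) (k := b) (fun j => ?_) a (by rwa [hda])
      rcases eq_or_ne j a with rfl | hja
      · rw [hda]; exact hba.le
      by_cases hjb : j = b
      · rw [hjb, hdb]; exact (h.lt_one_of_swap hba).le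
      refine (h.entry_lt_entry ?_ (hb j hja).ge hv).le
      by_cases hjc : j = c
      · rw [hjc]; exact h2.le
      · exact (ha j hjb hjc).le

theorem not_isCut_of_adjacent (h : IsBalanced E v lam) (hcard : 4 ≤ Fintype.card ι) {a b c : ι}
    (hab : a ≠ b) (hac : a ≠ c) (hbc : b ≠ c) (h1 : E a b ≠ v a / v b) (h2 : E a c ≠ v a / v c)
    (hE : ∀ p q, s(p, q) ≠ s(a, b) → s(p, q) ≠ s(a, c) → E p q = v p / v q) (S : Set ι) :
    ¬ IsCut E S := by
  classical
  obtain ⟨u, hu⟩ : ∃ u, u ∉ ({a, b, c} : Finset ι) := by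
    by_contra! hall
    have := Finset.card_le_three (a := a) (b := b) (c := c)
    rw [Finset.eq_univ_iff_forall.mpr hall, Finset.card_univ] at this
    omega
  simp only [Finset.mem_insert, Finset.mem_singleton, not_or] at hu
  obtain ⟨hua, hub, huc⟩ := hu
  rcases lt_or_gt_of_ne h1 with h1 | h1 <;> rcases lt_or_gt_of_ne h2 with h2 | h2
  · exact h.not_isCut_of_lowered hab hac hbc hua hub huc h1 h2 hE S
  · exact h.not_isCut_of_mixed hac hab hbc.symm hua huc hub h2 h1
      (fun p q hp hq => hE p q hq hp) S
  · exact h.not_isCut_of_mixed hab hac hbc hua hub huc h1 h2 hE S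
  · exact h.not_isCut_of_raised hab hac hbc hua hub huc h1 h2 hE S

/-! ### Reduction to the two configurations. -/

/-- A balanced array that differs from `v i / v j` exactly at two pairs has no cut. -/
theorem not_isCut (h : IsBalanced E v lam) (hcard : 4 ≤ Fintype.card ι) {i j k l : ι}
    (hij : i ≠ j) (hkl : k ≠ l) (hne : s(i, j) ≠ s(k, l))
    (hE : ∀ p q, E p q ≠ v p / v q ↔ (s(p, q) = s(i, j) ∨ s(p, q) = s(k, l))) (S : Set ι) :
    ¬ IsCut E S := by
  have hE' : ∀ p q, s(p, q) ≠ s(i, j) → s(p, q) ≠ s(k, l) → E p q = v p / v q :=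
    fun p q h1 h2 => by
      by_contra hpq
      exact ((hE p q).mp hpq).elim h1 h2
  have n1 := (hE i j).mpr (Or.inl rfl)
  have n1' := (hE j i).mpr (Or.inl Sym2.eq_swap)
  have n2 := (hE k l).mpr (Or.inr rfl)
  have n2' := (hE l k).mpr (Or.inr Sym2.eq_swap)
  -- A lowered entry has a raised reciprocal, so disjoint pairs can be oriented to be raised.
  have flip : ∀ {a b : ι}, E a b ≠ v a / v b →
      v a / v b < E a b ∨ v b / v a < E b a := fun hne =>
    (lt_or_gt_of_ne hne).elim (fun h' => Or.inr (h.div_lt_swap h')) Or.inl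
  by_cases hik : i = k
  · subst hik
    exact h.not_isCut_of_adjacent hcard hij hkl (by grind) n1 n2 hE' S
  by_cases hil : i = l
  · subst hil
    rw [Sym2.eq_swap (a := k)] at hne hE'
    exact h.not_isCut_of_adjacent hcard hij hkl.symm (by grind) n1 n2' hE' S
  by_cases hjk : j = k
  · subst hjk
    simp only [Sym2.eq_swap (a := i) (b := j)] at hE'
    exact h.not_isCut_of_adjacent hcard hij.symm hkl hil n1' n2 hE' S
  by_cases hjl : j = l
  · subst hjl
    simp only [Sym2.eq_swap (a := i) (b := j), Sym2.eq_swap (a := k) (b := j)] at hE'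
    exact h.not_isCut_of_adjacent hcard hij.symm hkl.symm hik n1' n2' hE' S
  rcases flip n1 with h1 | h1 <;> rcases flip n2 with h2 | h2
  · exact h.not_isCut_of_disjoint hij hkl hik hil hjk hjl h1 h2 hE' S
  · simp only [Sym2.eq_swap (a := k) (b := l)] at hE'
    exact h.not_isCut_of_disjoint hij hkl.symm hil hik hjl hjk h1 h2 hE' S
  · simp only [Sym2.eq_swap (a := i) (b := j)] at hE'
    exact h.not_isCut_of_disjoint hij.symm hkl hjk hjl hik hil h1 h2 hE' S
  · simp only [Sym2.eq_swap (a := k) (b := l), Sym2.eq_swap (a := i) (b := j)] at hE'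
    exact h.not_isCut_of_disjoint hij.symm hkl.symm hjl hjk hil hik h1 h2 hE' S

end IsBalanced

/-! ### From cuts to efficiency. -/

/-- A positive vector is efficient when the array `a i j * w j / w i` has no cut. -/
theorem isEfficient_of_forall_not_isCut {n : ℕ} {A : Matrix (Fin n) (Fin n) ℝ} {w : Fin n → ℝ}
    (hw : ∀ i, 0 < w i) (hcut : ∀ S, ¬ IsCut (fun i j => A i j * w j / w i) S) :
    IsEfficient A w := by
  refine ⟨hw, ?_⟩
  rintro ⟨w', hw', hle, k, l, hlt⟩
  obtain ⟨m, -, hm⟩ := Finset.exists_max_image Finset.univ (fun i => w' i / w i)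
    ⟨k, Finset.mem_univ k⟩
  refine hcut {i | w' i / w i = w' m / w m} ⟨⟨m, rfl⟩, ?_, ?_⟩
  -- If w'/w is constant, all ratios agree and nothing improves strictly.
  · by_contra! hall
    have hk : w' k / w k = w' m / w m := hall k
    have hl : w' l / w l = w' m / w m := hall l
    have hkl : w' k / w' l = w k / w l := by
      have h1 := (hw k).ne'
      have h2 := (hw l).ne'
      have h3 := (hw' l).ne'
      have := hk.trans hl.symm
      field_simp at this ⊢
      linarith
    rw [hkl] at hlt
    exact lt_irrefl _ hlt
  · intro i hi j hj
    have hji : w' j / w j < w' i / w i := by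
      rw [show w' i / w i = w' m / w m from hi]
      exact lt_of_le_of_ne (hm j (Finset.mem_univ j)) hj
    have hratio : w i / w j < w' i / w' j := by
      rw [div_lt_div_iff₀ (hw j) (hw i)] at hji
      rw [div_lt_div_iff₀ (hw j) (hw' j)]
      linarith
    -- Otherwise the larger ratio of w' would move away from `A i j`.
    have hlt : w i / w j < A i j := by
      by_contra! hge
      have := hle i j
      rw [abs_of_nonpos (by linarith), abs_of_nonpos (by linarith)] at this
      linarith
    show 1 < A i j * w j / w i
    rw [div_lt_iff₀ (hw j)] at hlt
    rwa [one_lt_div (hw i)]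

end PairwiseComparison

theorem mainTheorem1 (n : ℕ) (hn : 4 ≤ n) (A : Matrix (Fin n) (Fin n) ℝ)
    (hA : PairwiseComparison.IsDoublePerturbed A) (w : Fin n → ℝ)
    (hw : PairwiseComparison.IsPrincipalRightEigenvector A w) :
    PairwiseComparison.IsEfficient A w := by
  obtain ⟨hpcm, B, hB, i, j, k, l, hij, hkl, hne, hAB⟩ := hA
  obtain ⟨hwpos, lam, -, heig⟩ := hw
  refine PairwiseComparison.isEfficient_of_forall_not_isCut hwpos fun S => ?_
  -- Any column of B serves: by consistency its ratios recover all of B.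
  have hbal : PairwiseComparison.IsBalanced (fun i j => A i j * w j / w i)
      (fun p => B p i / w p) lam := by
    refine ⟨fun p q => ?_, fun p q => ?_, fun p => ?_, fun p => ?_⟩
    · exact div_pos (mul_pos (hpcm.pos p q) (hwpos q)) (hwpos p)
    · have h1 := (hwpos p).ne'
      have h2 := (hwpos q).ne'
      have h3 := (hpcm.pos q p).ne'
      rw [hpcm.reciprocal p q]
      field_simp
    · exact div_pos (hB.isPCM.pos p i) (hwpos p)
    · have := congrFun heig p
      simp only [Matrix.mulVec, dotProduct, Pi.smul_apply, smul_eq_mul] at this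
      rw [← Finset.sum_div, this, mul_div_cancel_right₀ _ (hwpos p).ne']
  refine hbal.not_isCut (by simpa using hn) hij hkl hne (fun p q => ?_) S
  rw [← hAB p q]
  have h1 := (hwpos p).ne'
  have h2 := (hwpos q).ne'
  have h3 := (hB.isPCM.pos q i).ne'
  have hv : B p i / w p / (B q i / w q) = B p q * w q / w p := by
    rw [← hB.trans p i q]
    field_simp
  rw [hv, ne_eq, ne_eq, div_left_inj' h1, mul_left_inj' h2]
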